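/- \textbf{Setting.} Fix $p\in\mathbb N=\{0,1,2,\dots\}$ and $r>0$. Let $\mathcal H^0=\{x\in\mathbb R^p:\|x\|_2\le r\}$ and, for $t\ge 0$, $\mathcal H^{t+1}=\mathcal H^t\times\mathscr M_{\le 1}(\mathcal H^t)$, where $\mathscr M_{\le1}(X)$ is the space of nonnegative Borel measures on $X$ of total mass $\|\mu\|=\mu(X)\le 1$ with the weak$^*$ topology and products carry the product topology. Write elements of $\mathcal H^t$ as $\tau=(\tau_0,\dots,\tau_t)$, and let $\mathscr P(\mathcal H^L)$ be the set of Borel probability measures on $\mathcal H^L$ (\emph{DIDMs} of order $L$). For $d:X\times X\to[0,\infty)$ and finite measures $\mu,\nu$ on $X$ with $\|\mu\|\le\|\nu\|$ put $$\mathbf{OT}_d(\mu,\nu)=\inf_\gamma\int_{X\times X}d\,\mathrm d\gamma+\big|\|\mu\|-\|\nu\|\big|,$$ the infimum being over the measures $\gamma$ on $X\times X$ with first marginal $\mu$ and second marginal $\le\nu$; if $\|\mu\|>\|\nu\|$ the roles of the two marginals are exchanged. Let $d^0_{\rm IDM}(\sigma,\tau)=\|\sigma_0-\tau_0\|_2$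 and $d^t_{\rm IDM}(\sigma,\tau)=\|\sigma_0-\tau_0\|_2+\sum_{j=1}^t\mathbf{OT}_{d^{j-1}_{\rm IDM}}(\sigma_j,\tau_j)$. An \emph{$L$-layer MPNN with readout} and output dimension $d$ is a pair $(\varphi,\psi)$ of Lipschitz maps $\varphi^{(0)}:\mathbb R^p\to\mathbb R^{d_0}$, $\varphi^{(t)}:\mathbb R^{2d_{t-1}}\to\mathbb R^{d_t}$ ($1\le t\le L$), and $\psi:\mathbb R^{d_L}\to\mathbb R^d$, with arbitrary $d_0,\dots,d_L\in\mathbb N$. Put $\mathfrak h^{(0)}_\tau=\varphi^{(0)}(\tau)$, $$\mathfrak h^{(t)}_\tau=\varphi^{(t)}\Big(\mathfrak h^{(t-1)}_{(\tau_0,\dots,\tau_{t-1})},\int_{\mathcal H^{t-1}}\mathfrak h^{(t-1)}\,\mathrm d\tau_t\Big),\qquad \mathfrak H(\varphi,\psi,\mu)=\psi\Big(\int_{\mathcal H^L}\mathfrak h^{(L)}\,\mathrm d\mu\Big).$$ With $\|f\|_{\rm L}$ the best Lipschitz constant of $f$ and $\|\cdot\|_\infty$ the supremum norm, let $C^0_\varphi=\|\varphi^{(0)}\|_{\rm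 L}$, $C^t_\varphi=2\|\varphi^{(t)}\|_{\rm L}\big(\|\mathfrak h^{(t-1)}\|_\infty+C^{t-1}_\varphi\big)$ and $C_{(\varphi,\psi)}=\|\psi\|_{\rm L}\big(\|\mathfrak h^{(L)}\|_\infty+C^L_\varphi\big)$. \textbf{Theorem.} Let $d>0$ be fixed. For every $\varepsilon>0$ and every $L\in\mathbb N$ there are $C>0$ and $\delta>0$ such that, for all DIDMs $\mu,\nu\in\mathscr P(\mathcal H^L)$: if $\|\mathfrak H(\varphi,\psi,\mu)-\mathfrak H(\varphi,\psi,\nu)\|_2\le\delta$ for every $L$-layer MPNN with readout $(\varphi,\psi)$ with output dimension $d$ and $C_{(\varphi,\psi)}\le C$, then $\mathbf{OT}_{d^L_{\rm IDM}}(\mu,\nu)\le\varepsilon$. (In particular, for every $\varepsilon>0$ there are $L$, $C$ and $\delta$ with this property.) -/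

import Mathlib

open MeasureTheory
open scoped NNReal ENNReal

noncomputable section

/-- `ℝⁿ` with the Euclidean norm. -/
abbrev Euc (n : ℕ) : Type := EuclideanSpace ℝ (Fin n)

/-- `ℝⁿ × ℝⁿ` with the Euclidean norm, that is `ℝ²ⁿ`. -/
abbrev EucPair (n : ℕ) : Type := WithLp 2 (Euc n × Euc n)

/-- The space `ℳ_{≤ 1}(X)` of nonnegative Borel measures of total mass at most one. -/
def SubProb (X : Type) [MeasurableSpace X] : Type :=
  {μ : FiniteMeasure X // μ.mass ≤ 1}

/-- The weak-* topology, generated by the maps `μ ↦ ∫ f dμ` for bounded continuous `f`. -/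
instance (X : Type) [TopologicalSpace X] [MeasurableSpace X] [OpensMeasurableSpace X] :
    TopologicalSpace (SubProb X) :=
  inferInstanceAs (TopologicalSpace {μ : FiniteMeasure X // μ.mass ≤ 1})

/-- A topological space together with its Borel `σ`-algebra. -/
structure BorelSp where
  carrier : Type
  [top : TopologicalSpace carrier]
  [meas : MeasurableSpace carrier]
  [isBorel : BorelSpace carrier]

attribute [instance] BorelSp.top BorelSp.meas BorelSp.isBorel

/-- The spaces `ℋ⁰ = {x ∈ ℝᵖ : ‖x‖ ≤ r}` and `ℋᵗ⁺¹ = ℋᵗ × ℳ_{≤ 1}(ℋᵗ)`, with the product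
topology and its Borel `σ`-algebra. -/
def idmSp (p : ℕ) (r : ℝ) : ℕ → BorelSp
  | 0 => { carrier := Metric.closedBall (0 : Euc p) r }
  | t + 1 =>
    { carrier := (idmSp p r t).carrier × SubProb (idmSp p r t).carrier
      meas := borel _
      isBorel := @BorelSpace.mk _ _ (borel _) rfl }

/-- The space `ℋᵗ` of iterated degree measures (IDMs) of order `t` over the ball of radius `r`
in `ℝᵖ`. -/
def IDM (p : ℕ) (r : ℝ) (t : ℕ) : Type := (idmSp p r t).carrier

namespace IDM

variable {p : ℕ} {r : ℝ} {t : ℕ}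

instance : TopologicalSpace (IDM p r t) := inferInstanceAs (TopologicalSpace (idmSp p r t).carrier)

instance : MeasurableSpace (IDM p r t) := inferInstanceAs (MeasurableSpace (idmSp p r t).carrier)

instance : BorelSpace (IDM p r t) := inferInstanceAs (BorelSpace (idmSp p r t).carrier)

/-- The underlying vector of an IDM of order zero. -/
def vec (τ : IDM p r 0) : Euc p := Subtype.val (p := (· ∈ Metric.closedBall (0 : Euc p) r)) τ

/-- The projection `ℋᵗ⁺¹ → ℋᵗ` which forgets the last entry. -/
def init (τ : IDM p r (t + 1)) : IDM p r t :=
  Prod.fst (α := IDM p r t) (β := SubProb (IDM p r t)) τ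

/-- The projection `ℋᵗ⁺¹ → ℳ_{≤ 1}(ℋᵗ)` to the last entry. -/
def last (τ : IDM p r (t + 1)) : FiniteMeasure (IDM p r t) :=
  (Prod.snd (α := IDM p r t) (β := SubProb (IDM p r t)) τ).1

end IDM

/-- The space `𝒫(ℋᴸ)` of distributions of iterated degree measures (DIDMs) of order `L`. -/
abbrev DIDM (p : ℕ) (r : ℝ) (L : ℕ) : Type := ProbabilityMeasure (IDM p r L)

/-- Couplings of measures of possibly different mass: the marginal on the side of the smaller
mass is the given measure, the other marginal is dominated by the given measure. (For equal masses
the two alternatives agree.) -/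
def IsCoupling {X : Type} [MeasurableSpace X] (γ : Measure (X × X)) (μ ν : FiniteMeasure X) :
    Prop :=
  (μ.mass ≤ ν.mass ∧ γ.fst = (μ : Measure X) ∧ γ.snd ≤ (ν : Measure X)) ∨
    (ν.mass ≤ μ.mass ∧ γ.fst ≤ (μ : Measure X) ∧ γ.snd = (ν : Measure X))

/-- Unbalanced optimal transport with ground distance `d`:
`inf_γ ∫ d(x, y) dγ(x, y) + |‖μ‖ - ‖ν‖|`, the infimum being over all couplings. -/
def OT {X : Type} [MeasurableSpace X] (d : X → X → ℝ≥0∞) (μ ν : FiniteMeasure X) : ℝ≥0∞ :=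
  (⨅ (γ : Measure (X × X)) (_ : IsCoupling γ μ ν), ∫⁻ z, d z.1 z.2 ∂γ) + edist μ.mass ν.mass

/-- The IDM distance `d_IDM(σ, τ) = ‖σ₀ - τ₀‖ + ∑_{1 ≤ j ≤ t} OT(σ_j, τ_j)`, where the ground
distance of the `j`-th transport distance is the IDM distance of order `j - 1`. -/
def dIDM {p : ℕ} {r : ℝ} : (t : ℕ) → IDM p r t → IDM p r t → ℝ≥0∞
  | 0, σ, τ => edist σ.vec τ.vec
  | t + 1, σ, τ => dIDM t σ.init τ.init + OT (dIDM t) σ.last τ.last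

/-- Message passing models `φ = (φ⁽⁰⁾, …, φ⁽ᴸ⁾)` with input dimension `p`, number of layers `L`
and last hidden dimension `n`, where `φ⁽⁰⁾ : ℝᵖ → ℝ^{d₀}` and `φ⁽ᵗ⁾ : ℝ^{2 d_{t-1}} → ℝ^{d_t}`
are Lipschitz continuous. -/
inductive MPNN (p : ℕ) : (L n : ℕ) → Type
  | start {n : ℕ} (f : Euc p → Euc n) (hf : ∃ K : ℝ≥0, LipschitzWith K f) : MPNN p 0 n
  | layer {L m n : ℕ} (φ : MPNN p L m) (f : EucPair m → Euc n)
      (hf : ∃ K : ℝ≥0, LipschitzWith K f) : MPNN p (L + 1) n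

/-- The optimal Lipschitz constant of `f` (infinite if `f` is not Lipschitz). -/
def lipNorm {X Y : Type} [PseudoEMetricSpace X] [PseudoEMetricSpace Y] (f : X → Y) : ℝ≥0∞ :=
  ⨅ (K : ℝ≥0) (_ : LipschitzWith K f), (K : ℝ≥0∞)

namespace MPNN

variable {p d : ℕ} (r : ℝ)

/-- The hidden representation `𝔥⁽ᴸ⁾` of an IDM of order `L`. -/
def feature : {L n : ℕ} → MPNN p L n → IDM p r L → Euc n
  | _, _, start f _, τ => f τ.vec
  | _, _, layer φ f _, τ =>
    f (WithLp.toLp 2 (φ.feature τ.init, ∫ σ, φ.feature σ ∂(τ.last : Measure _)))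

/-- The output `ℌ` of a message passing model with readout `ψ` on a DIDM. -/
def output {L n : ℕ} (φ : MPNN p L n) (ψ : Euc n → Euc d) (ν : DIDM p r L) : Euc d :=
  ψ (∫ τ, φ.feature r τ ∂(ν : Measure (IDM p r L)))

/-- `‖𝔥⁽ᴸ⁾‖_∞`, the supremum of the norm of the hidden representation over all IDMs. -/
def supNorm {L n : ℕ} (φ : MPNN p L n) : ℝ≥0∞ := ⨆ τ : IDM p r L, ‖φ.feature r τ‖ₑ

/-- The Lipschitz bound `C_φ` of a model: `C⁰ = ‖φ⁽⁰⁾‖_L` and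
`Cᵗ = 2 ‖φ⁽ᵗ⁾‖_L (‖𝔥⁽ᵗ⁻¹⁾‖_∞ + Cᵗ⁻¹)`. -/
def lipBound : {L n : ℕ} → MPNN p L n → ℝ≥0∞
  | _, _, start f _ => lipNorm f
  | _, _, layer φ f _ => 2 * lipNorm f * (φ.supNorm r + φ.lipBound)

/-- The Lipschitz bound `C_{(φ, ψ)} = ‖ψ‖_L (‖𝔥⁽ᴸ⁾‖_∞ + C_φ)` of a model with readout. -/
def readoutLipBound {L n : ℕ} (φ : MPNN p L n) (ψ : Euc n → Euc d) : ℝ≥0∞ :=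
  lipNorm ψ * (φ.supNorm r + φ.lipBound r)

end MPNN

end

/-!
Hidden features of message passing models determine the transport distance of DIDMs because, for
every `η > 0` and every order `L`, there is a single model of order `L` whose coordinates form a
partition of unity on the space of IDMs with pieces of `dIDM`-diameter at most `η`
(`MPNN.exists_isPartition`).

Given such a partition `χ₁, …, χ_N`, two measures `μ, ν` with nearly equal integrals `∫ χᵢ` are
close in transport distance: the common part of `∫ χᵢ dμ` and `∫ χᵢ dν` is transported within the
`i`-th piece at cost at most `η` per unit mass, by a multiple of the product of `χᵢ μ` and `χᵢ ν`,
and the small remaining mass is transported arbitrarily at bounded cost (`OT_le_of_partition`).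
The theorem follows by testing with the finitely many readouts that extract one coordinate.

The partitions are constructed by induction on the order. If the hidden representation `𝔥` of a
model controls `dIDM`, in the sense that `‖𝔥 σ - 𝔥 τ‖ ≤ κ` implies `dIDM σ τ ≤ η`, then composing
it with a Lipschitz partition of unity of a ball of `ℝⁿ` into pieces of diameter at most `κ`
(`exists_lipschitz_partition`) gives a partition of unity by hidden features, since the Lipschitz
map is absorbed into the last layer. Conversely, from a partition at order `L` the next layer may
retain the values of the `χᵢ` at the initial segment and their integrals against the last entry.
The former control the distance of the initial segments (two points at which all values are nearly
equal share a piece), the latter control the transport distance of the last entries by the bound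
above; together they control `dIDM` at order `L + 1` (`MPNN.IsPartition.exists_separating`). No
compactness of the spaces of IDMs is used.
-/

/-! ### Lipschitz partitions of unity -/

theorem exists_lipschitzWith_sum_range {X : Type} [PseudoMetricSpace X] {u : ℕ → X → ℝ}
    (hu : ∀ j, ∃ K : ℝ≥0, LipschitzWith K (u j)) (k : ℕ) :
    ∃ K : ℝ≥0, LipschitzWith K fun x => ∑ j ∈ Finset.range k, u j x := by
  induction k with
  | zero => exact ⟨0, by simp⟩
  | succ k ih =>
    obtain ⟨K, hK⟩ := ih
    obtain ⟨K', hK'⟩ := hu k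
    exact ⟨K + K', by simpa only [Finset.sum_range_succ] using hK.add hK'⟩

theorem exists_lipschitzWith_toLp {X : Type} [PseudoMetricSpace X] {N : ℕ} {g : Fin N → X → ℝ}
    (hg : ∀ i, ∃ K : ℝ≥0, LipschitzWith K (g i)) :
    ∃ K : ℝ≥0, LipschitzWith K fun x => (WithLp.toLp 2 fun i => g i x : Euc N) := by
  choose K hK using hg
  have h : LipschitzWith (∑ i, K i) fun x i => g i x := by
    refine fun x y => edist_pi_le_iff.2 fun i => ?_
    refine (hK i x y).trans ?_
    gcongr
    exact Finset.single_le_sum (f := K) (fun _ _ => zero_le) (Finset.mem_univ i)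
  exact ⟨_, (PiLp.lipschitzWith_toLp 2 fun _ : Fin N => ℝ).comp h⟩

/-- A finite partition of unity on a ball of `ℝⁿ` into small pieces which, collected into a single
map, is globally Lipschitz. The pieces are the increments of the truncated partial sums
`min 1 (∑_{j < k} uⱼ)` of tent functions `uⱼ`, so that no quotient is needed. -/
theorem exists_lipschitz_partition {n : ℕ} (R : ℝ) {κ : ℝ} (hκ : 0 < κ) :
    ∃ (N : ℕ) (g : Euc n → Euc N), (∃ K : ℝ≥0, LipschitzWith K g) ∧ (∀ x i, 0 ≤ g x i) ∧
      (∀ x, ‖x‖ ≤ R → ∑ i, g x i = 1) ∧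
      ∀ x y i, g x i ≠ 0 → g y i ≠ 0 → dist x y ≤ κ := by
  let c : ℕ → Euc n := TopologicalSpace.denseSeq (Euc n)
  obtain ⟨N, hN⟩ := (isCompact_closedBall (0 : Euc n) R).elim_directed_cover
    (fun k => ⋃ j ∈ Finset.range k, Metric.ball (c j) (κ / 4))
    (fun k => isOpen_biUnion fun _ _ => Metric.isOpen_ball)
    (fun x _ => by
      obtain ⟨j, hj⟩ := (TopologicalSpace.denseRange_denseSeq (Euc n)).exists_dist_lt x
        (show 0 < κ / 4 by positivity)
      exact Set.mem_iUnion.2 ⟨j + 1, Set.mem_biUnion (Finset.self_mem_range_succ j) hj⟩)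
    (directed_of_isDirected_le fun k l hkl => Set.biUnion_subset_biUnion_left fun j hj =>
      Finset.range_mono hkl hj)
  -- `u j` is at least `1` on `ball (c j) (κ / 4)` and vanishes outside `ball (c j) (κ / 2)`.
  let u : ℕ → Euc n → ℝ := fun j x => max 0 (2 - dist x (c j) * (4 / κ))
  have hu0 : ∀ j x, 0 ≤ u j x := fun j x => le_max_left _ _
  have hu : ∀ j, ∃ K : ℝ≥0, LipschitzWith K (u j) := fun j => by
    have h : LipschitzWith (Real.toNNReal (4 / κ)) fun x => 2 - dist x (c j) * (4 / κ) := by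
      refine LipschitzWith.of_dist_le_mul fun x y => ?_
      rw [Real.coe_toNNReal _ (by positivity), Real.dist_eq]
      have h1 := abs_dist_sub_le x y (c j)
      calc |2 - dist x (c j) * (4 / κ) - (2 - dist y (c j) * (4 / κ))|
          = |dist x (c j) - dist y (c j)| * (4 / κ) := by
            rw [← abs_of_pos (show 0 < 4 / κ by positivity), ← abs_mul, ← abs_neg,
              abs_of_pos (show 0 < 4 / κ by positivity)]
            congr 1
            ring
        _ ≤ 4 / κ * dist x y := by
            rw [mul_comm]
            gcongr
    exact ⟨_, h.const_max 0⟩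
  let S : ℕ → Euc n → ℝ := fun k x => min 1 (∑ j ∈ Finset.range k, u j x)
  have hS : ∀ k, ∃ K : ℝ≥0, LipschitzWith K (S k) := fun k => by
    obtain ⟨K, hK⟩ := exists_lipschitzWith_sum_range hu k
    exact ⟨K, hK.const_min 1⟩
  have hdist : ∀ x (i : ℕ), S (i + 1) x - S i x ≠ 0 → dist x (c i) < κ / 2 := by
    intro x i hx
    by_contra! hle
    apply hx
    have : u i x = 0 := by
      refine max_eq_left ?_
      have : κ / 2 * (4 / κ) = 2 := by field_simp; norm_num
      nlinarith [mul_le_mul_of_nonneg_right hle (show 0 ≤ 4 / κ by positivity)]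
    simp [S, Finset.sum_range_succ, this]
  refine ⟨N, fun x => WithLp.toLp 2 fun i : Fin N => S (i + 1) x - S i x, ?_, ?_, ?_, ?_⟩
  · refine exists_lipschitzWith_toLp fun i => ?_
    obtain ⟨K, hK⟩ := hS (i + 1)
    obtain ⟨K', hK'⟩ := hS i
    exact ⟨_, hK.sub hK'⟩
  · intro x i
    simp only [S, sub_nonneg, Finset.sum_range_succ]
    gcongr
    linarith [hu0 i x]
  · intro x hx
    simp only
    rw [Fin.sum_univ_eq_sum_range (fun i => S (i + 1) x - S i x),
      Finset.sum_range_sub fun i => S i x]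
    obtain ⟨j, hj, hxj⟩ := Set.mem_iUnion₂.1 (hN (mem_closedBall_zero_iff.2 hx))
    have h1 : 1 ≤ u j x := by
      refine le_max_of_le_right ?_
      have : κ / 4 * (4 / κ) = 1 := by field_simp
      nlinarith [mul_le_mul_of_nonneg_right (Metric.mem_ball.1 hxj).le
        (show 0 ≤ 4 / κ by positivity)]
    have h2 : 1 ≤ ∑ j ∈ Finset.range N, u j x :=
      h1.trans (Finset.single_le_sum (f := fun j => u j x) (fun j _ => hu0 j x) hj)
    simp [S, h2]
  · intro x y i hx hy
    have h1 := hdist x i hx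
    have h2 := hdist y i hy
    have h3 := dist_triangle_right x y (c i)
    linarith

/-! ### Transport along a partition of unity -/

section Glue

variable {X : Type} [MeasurableSpace X]

/-- The product measure, scaled so that both marginals are dominated by the given measures and the
marginal on the side of the smaller mass is the given measure. If both masses vanish, the scalar is
`∞` and the product is the zero measure. -/
noncomputable def glue (α β : Measure X) : Measure (X × X) :=
  (max (α Set.univ) (β Set.univ))⁻¹ • α.prod β

theorem glue_fst (α β : Measure X) [IsFiniteMeasure β] :
    (glue α β).fst = ((max (α Set.univ) (β Set.univ))⁻¹ * β Set.univ) • α := by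
  rw [glue, Measure.fst, Measure.map_smul, Measure.map_fst_prod, smul_smul]

theorem glue_snd (α β : Measure X) [IsFiniteMeasure β] :
    (glue α β).snd = ((max (α Set.univ) (β Set.univ))⁻¹ * α Set.univ) • β := by
  rw [glue, Measure.snd, Measure.map_smul, Measure.map_snd_prod, smul_smul]

theorem smul_measure_le_self {c : ℝ≥0∞} (hc : c ≤ 1) (μ : Measure X) : c • μ ≤ μ :=
  Measure.le_iff'.2 fun s => by simpa using mul_le_mul_left hc (μ s)

theorem glue_fst_le (α β : Measure X) [IsFiniteMeasure β] : (glue α β).fst ≤ α := by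
  rw [glue_fst]
  refine smul_measure_le_self ?_ _
  rw [mul_comm]
  exact ENNReal.div_le_of_le_mul (by simp)

theorem glue_snd_le (α β : Measure X) [IsFiniteMeasure β] : (glue α β).snd ≤ β := by
  rw [glue_snd]
  refine smul_measure_le_self ?_ _
  rw [mul_comm]
  exact ENNReal.div_le_of_le_mul (by simp)

theorem glue_fst_eq (α β : Measure X) [IsFiniteMeasure β]
    (h : α Set.univ ≤ β Set.univ) : (glue α β).fst = α := by
  rw [glue_fst, max_eq_right h]
  by_cases h0 : β Set.univ = 0
  · have : α = 0 := Measure.measure_univ_eq_zero.1 (le_antisymm (h.trans h0.le) zero_le)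
    simp [this]
  · rw [ENNReal.inv_mul_cancel h0 (measure_ne_top _ _), one_smul]

theorem glue_snd_eq (α β : Measure X) [IsFiniteMeasure α] [IsFiniteMeasure β]
    (h : β Set.univ ≤ α Set.univ) : (glue α β).snd = β := by
  rw [glue_snd, max_eq_left h]
  by_cases h0 : α Set.univ = 0
  · have : β = 0 := Measure.measure_univ_eq_zero.1 (le_antisymm (h.trans h0.le) zero_le)
    simp [this]
  · rw [ENNReal.inv_mul_cancel h0 (measure_ne_top _ _), one_smul]

theorem glue_univ (α β : Measure X) [IsFiniteMeasure α] [IsFiniteMeasure β] :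
    glue α β Set.univ = min (α Set.univ) (β Set.univ) := by
  rcases le_total (α Set.univ) (β Set.univ) with h | h
  · rw [← Measure.fst_univ, glue_fst_eq α β h, min_eq_left h]
  · rw [← Measure.snd_univ, glue_snd_eq α β h, min_eq_right h]

theorem lintegral_glue_le (α β : Measure X) {d : X → X → ℝ≥0∞} {η : ℝ≥0∞} {A B : Set X}
    (hα : α Aᶜ = 0) (hβ : β Bᶜ = 0)
    (hd : ∀ x ∈ A, ∀ y ∈ B, d x y ≤ η) :
    ∫⁻ z, d z.1 z.2 ∂glue α β ≤ η * glue α β Set.univ := by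
  have h : ∀ᵐ z ∂glue α β, d z.1 z.2 ≤ η := by
    refine Measure.ae_smul_measure ?_ _
    have h1 : ∀ᵐ z ∂α.prod β, z.1 ∈ A := Measure.quasiMeasurePreserving_fst.ae hα
    have h2 : ∀ᵐ z ∂α.prod β, z.2 ∈ B := Measure.quasiMeasurePreserving_snd.ae hβ
    filter_upwards [h1, h2] with z hz1 hz2 using hd _ hz1 _ hz2
  exact (lintegral_mono_ae h).trans (by simp)

end Glue

theorem sum_withDensity_eq {X ι : Type} [MeasurableSpace X] [Fintype ι] {χ : ι → X → ℝ≥0∞}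
    (hχ : ∀ i, Measurable (χ i)) (hsum : ∀ x, ∑ i, χ i x = 1) (μ : Measure X) :
    Measure.sum (fun i => μ.withDensity (χ i)) = μ := by
  rw [← withDensity_tsum hχ]
  have : ∑' i, χ i = 1 := by
    rw [tsum_fintype]
    ext x
    simp [hsum]
  rw [this, withDensity_one]

/-- If the pieces of a partition of unity have diameter at most `η`, then transporting mass within
each piece, and the remaining mass arbitrarily, bounds the transport distance in terms of the
differences between the masses of the pieces. No measurability of the ground distance is needed. -/
theorem OT_le_of_partition {X ι : Type} [MeasurableSpace X] [Fintype ι] {d : X → X → ℝ≥0∞}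
    {D η : ℝ≥0∞} {χ : ι → X → ℝ≥0∞} (hχ : ∀ i, Measurable (χ i)) (hsum : ∀ x, ∑ i, χ i x = 1)
    (hD : ∀ x y, d x y ≤ D) (hη : ∀ x y i, χ i x ≠ 0 → χ i y ≠ 0 → d x y ≤ η)
    {μ ν : FiniteMeasure X} (hμ : μ.mass ≤ 1) :
    OT d μ ν ≤ η + D * ∑ i, ((∫⁻ x, χ i x ∂(μ : Measure X)) - ∫⁻ x, χ i x ∂(ν : Measure X)) +
      edist μ.mass ν.mass := by
  unfold OT
  gcongr
  let α : ι → Measure X := fun i => (μ : Measure X).withDensity (χ i)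
  let β : ι → Measure X := fun i => (ν : Measure X).withDensity (χ i)
  have hα : Measure.sum α = μ := sum_withDensity_eq hχ hsum _
  have hβ : Measure.sum β = ν := sum_withDensity_eq hχ hsum _
  have hαf : ∀ i, IsFiniteMeasure (α i) := fun i =>
    isFiniteMeasure_of_le _ ((Measure.le_sum α i).trans hα.le)
  have hβf : ∀ i, IsFiniteMeasure (β i) := fun i =>
    isFiniteMeasure_of_le _ ((Measure.le_sum β i).trans hβ.le)
  let γ : Measure (X × X) := Measure.sum fun i => glue (α i) (β i)
  have hγ1 : γ.fst ≤ μ := by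
    rw [Measure.fst_sum, ← hα, Measure.le_iff]
    intro s hs
    simp only [Measure.sum_apply _ hs]
    exact ENNReal.tsum_le_tsum fun i => glue_fst_le (α i) (β i) s
  have hγ2 : γ.snd ≤ ν := by
    rw [Measure.snd_sum, ← hβ, Measure.le_iff]
    intro s hs
    simp only [Measure.sum_apply _ hs]
    exact ENNReal.tsum_le_tsum fun i => glue_snd_le (α i) (β i) s
  have hγμ : γ Set.univ ≤ (μ : Measure X) Set.univ := by
    rw [← Measure.fst_univ]
    exact hγ1 _
  have : IsFiniteMeasure γ := ⟨hγμ.trans_lt (measure_lt_top _ _)⟩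
  -- The mass which `γ` does not transport; `α'` and `β'` compare in mass as `μ` and `ν` do.
  let α' : Measure X := μ - γ.fst
  let β' : Measure X := ν - γ.snd
  have hα' : α' + γ.fst = μ := Measure.sub_add_cancel_of_le hγ1
  have hβ' : β' + γ.snd = ν := Measure.sub_add_cancel_of_le hγ2
  have : IsFiniteMeasure α' := isFiniteMeasure_of_le _ Measure.sub_le
  have : IsFiniteMeasure β' := isFiniteMeasure_of_le _ Measure.sub_le
  have hα'u : α' Set.univ + γ Set.univ = μ.mass := by
    rw [← Measure.fst_univ, ← Measure.add_apply, hα', FiniteMeasure.ennreal_mass]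
  have hβ'u : β' Set.univ + γ Set.univ = ν.mass := by
    rw [← Measure.snd_univ, ← Measure.add_apply, hβ', FiniteMeasure.ennreal_mass]
  have hcoup : IsCoupling (γ + glue α' β') μ ν := by
    rcases le_total μ.mass ν.mass with h | h
    · have h' : α' Set.univ ≤ β' Set.univ := by
        rw [← ENNReal.add_le_add_iff_right (measure_ne_top γ Set.univ), hα'u, hβ'u]
        exact_mod_cast h
      refine Or.inl ⟨h, ?_, ?_⟩
      · rw [Measure.fst_add, glue_fst_eq _ _ h', add_comm, hα']
      · rw [Measure.snd_add, add_comm, ← hβ']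
        exact add_le_add_left (glue_snd_le _ _) _
    · have h' : β' Set.univ ≤ α' Set.univ := by
        rw [← ENNReal.add_le_add_iff_right (measure_ne_top γ Set.univ), hα'u, hβ'u]
        exact_mod_cast h
      refine Or.inr ⟨h, ?_, ?_⟩
      · rw [Measure.fst_add, add_comm, ← hα']
        exact add_le_add_left (glue_fst_le _ _) _
      · rw [Measure.snd_add, glue_snd_eq _ _ h', add_comm, hβ']
  refine le_trans (iInf₂_le (γ + glue α' β') hcoup) ?_
  rw [lintegral_add_measure]
  have hnull : ∀ (ρ : Measure X) (i : ι), ρ.withDensity (χ i) {x | χ i x ≠ 0}ᶜ = 0 := by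
    intro ρ i
    simp [withDensity_apply_eq_zero (hχ i)]
  gcongr
  · calc ∫⁻ z, d z.1 z.2 ∂γ = ∑' i, ∫⁻ z, d z.1 z.2 ∂glue (α i) (β i) := lintegral_sum_measure _ _
      _ ≤ ∑' i, η * glue (α i) (β i) Set.univ := by
        refine ENNReal.tsum_le_tsum fun i => ?_
        exact lintegral_glue_le _ _ (hnull _ i) (hnull _ i)
          fun x hx y hy => hη x y i hx hy
      _ = η * γ Set.univ := by
        rw [ENNReal.tsum_mul_left, Measure.sum_apply _ MeasurableSet.univ]
      _ ≤ η * 1 := by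
        gcongr
        refine hγμ.trans ?_
        rw [← FiniteMeasure.ennreal_mass]
        exact_mod_cast hμ
      _ = η := mul_one η
  · refine (lintegral_glue_le α' β' (A := .univ) (B := .univ) (by simp) (by simp)
      fun x _ y _ => hD x y).trans ?_
    gcongr
    rw [glue_univ]
    refine (min_le_left _ _).trans ?_
    have hμu : (μ : Measure X) Set.univ = ∑ i, α i Set.univ := by
      rw [← tsum_fintype (L := .unconditional _), ← Measure.sum_apply _ MeasurableSet.univ, hα]
    rw [← ENNReal.add_le_add_iff_right (measure_ne_top γ Set.univ), hα'u,
      FiniteMeasure.ennreal_mass, hμu, Measure.sum_apply _ MeasurableSet.univ, tsum_fintype,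
      ← Finset.sum_add_distrib]
    refine Finset.sum_le_sum fun i _ => ?_
    rw [glue_univ]
    simp only [α, β, withDensity_apply _ MeasurableSet.univ, Measure.restrict_univ]
    rcases le_total (∫⁻ x, χ i x ∂(μ : Measure X)) (∫⁻ x, χ i x ∂(ν : Measure X)) with h | h
    · rw [min_eq_left h]
      exact le_add_self
    · rw [min_eq_right h, tsub_add_cancel_of_le h]

/-! ### Iterated degree measures -/

theorem IDM.mass_last_le {p : ℕ} {r : ℝ} {t : ℕ} (τ : IDM p r (t + 1)) : τ.last.mass ≤ 1 :=
  (Prod.snd (α := IDM p r t) (β := SubProb (IDM p r t)) τ).2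

theorem IDM.norm_vec_le {p : ℕ} {r : ℝ} (τ : IDM p r 0) : ‖τ.vec‖ ≤ r :=
  mem_closedBall_zero_iff.1
    (Subtype.prop (p := (· ∈ Metric.closedBall (0 : Euc p) r)) τ)

theorem IDM.continuous_vec {p : ℕ} {r : ℝ} : Continuous (IDM.vec (p := p) (r := r)) :=
  continuous_subtype_val (p := (· ∈ Metric.closedBall (0 : Euc p) r))

theorem IDM.continuous_init {p : ℕ} {r : ℝ} {t : ℕ} :
    Continuous (IDM.init (p := p) (r := r) (t := t)) :=
  continuous_fst (X := IDM p r t) (Y := SubProb (IDM p r t))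

theorem IDM.continuous_last {p : ℕ} {r : ℝ} {t : ℕ} :
    Continuous (IDM.last (p := p) (r := r) (t := t)) :=
  (continuous_subtype_val (p := fun μ : FiniteMeasure (IDM p r t) => μ.mass ≤ 1)).comp
    (continuous_snd (X := IDM p r t) (Y := SubProb (IDM p r t)))

theorem exists_dIDM_le (p : ℕ) (r : ℝ) (L : ℕ) :
    ∃ D : ℝ≥0, ∀ σ τ : IDM p r L, dIDM L σ τ ≤ D := by
  induction L with
  | zero =>
    refine ⟨(r + r).toNNReal, fun σ τ => ?_⟩
    rw [dIDM, edist_dist]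
    exact ENNReal.ofReal_le_ofReal
      ((dist_le_norm_add_norm _ _).trans (add_le_add σ.norm_vec_le τ.norm_vec_le))
  | succ t ih =>
    obtain ⟨D, hD⟩ := ih
    refine ⟨D + (D + D * 1 + 1), fun σ τ => ?_⟩
    -- The trivial partition of unity, consisting of one piece of diameter at most `D`.
    have h := OT_le_of_partition (ι := Unit) (χ := fun _ _ => 1) (fun _ => measurable_const)
      (by simp) hD (fun x y _ _ _ => hD x y) (ν := τ.last) σ.mass_last_le
    simp only [dIDM]
    push_cast
    refine add_le_add (hD _ _) (h.trans (add_le_add (add_le_add le_rfl ?_) ?_))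
    · gcongr
      simp only [Finset.univ_unique, Finset.sum_singleton, lintegral_one]
      refine tsub_le_self.trans ?_
      rw [← FiniteMeasure.ennreal_mass]
      exact_mod_cast σ.mass_last_le
    · rw [edist_dist, ENNReal.ofReal_le_one, NNReal.dist_eq, abs_le]
      have h1 : (σ.last.mass : ℝ) ≤ 1 := by exact_mod_cast σ.mass_last_le
      have h2 : (τ.last.mass : ℝ) ≤ 1 := by exact_mod_cast τ.mass_last_le
      have h3 := σ.last.mass.coe_nonneg
      have h4 := τ.last.mass.coe_nonneg
      constructor <;> linarith

/-! ### Hidden features: continuity, bounds and composition -/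

theorem integrable_of_continuous_of_bounded {X : Type} [TopologicalSpace X] [MeasurableSpace X]
    [OpensMeasurableSpace X] {n : ℕ} {f : X → Euc n} (hf : Continuous f) {R : ℝ}
    (hR : ∀ x, ‖f x‖ ≤ R) (μ : FiniteMeasure X) : Integrable f (μ : Measure X) :=
  Integrable.of_bound hf.measurable.aestronglyMeasurable R (Filter.Eventually.of_forall hR)

theorem continuous_finiteMeasure_integral {X : Type} [TopologicalSpace X] [MeasurableSpace X]
    [OpensMeasurableSpace X] {n : ℕ} {f : X → Euc n} (hf : Continuous f) {R : ℝ}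
    (hR : ∀ x, ‖f x‖ ≤ R) :
    Continuous fun μ : FiniteMeasure X => ∫ x, f x ∂(μ : Measure X) := by
  have h : (fun μ : FiniteMeasure X => ∫ x, f x ∂(μ : Measure X)) = fun μ : FiniteMeasure X =>
      (WithLp.toLp 2 fun i => ∫ x, f x i ∂(μ : Measure X) : Euc n) := by
    ext μ i
    exact eval_integral_piLp
      (fun i => (integrable_of_continuous_of_bounded hf hR μ).eval_piLp i) i
  rw [h]
  refine (PiLp.continuous_toLp 2 _).comp (continuous_pi fun i => ?_)
  rw [continuous_iff_continuousAt]
  intro μ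
  exact FiniteMeasure.tendsto_iff_forall_integral_tendsto.1 Filter.tendsto_id
    (BoundedContinuousFunction.ofNormedAddCommGroup (fun x => f x i) (by fun_prop) R
      fun x => (PiLp.norm_apply_le _ i).trans (hR x))

theorem exists_norm_le_of_lipschitzWith {E F : Type} [SeminormedAddCommGroup E]
    [SeminormedAddCommGroup F] {f : E → F} (hf : ∃ K : ℝ≥0, LipschitzWith K f) (R : ℝ) :
    ∃ R' : ℝ, ∀ x, ‖x‖ ≤ R → ‖f x‖ ≤ R' := by
  obtain ⟨K, hK⟩ := hf
  refine ⟨‖f 0‖ + K * R, fun x hx => ?_⟩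
  have h1 := hK.dist_le_mul x 0
  rw [dist_eq_norm, dist_zero_right] at h1
  have h2 : (K : ℝ) * ‖x‖ ≤ K * R := by gcongr
  linarith [norm_le_norm_add_norm_sub' (f x) (f 0)]

theorem norm_integral_finiteMeasure_le {X : Type} [MeasurableSpace X] {n : ℕ} {f : X → Euc n}
    {R : ℝ} (hR0 : 0 ≤ R) (hR : ∀ x, ‖f x‖ ≤ R) {μ : FiniteMeasure X} (hμ : μ.mass ≤ 1) :
    ‖∫ x, f x ∂(μ : Measure X)‖ ≤ R := by
  refine (norm_integral_le_of_norm_le_const (Filter.Eventually.of_forall hR)).trans ?_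
  have : (μ : Measure X).real Set.univ ≤ 1 := by exact_mod_cast hμ
  nlinarith

theorem lipNorm_ne_top {X Y : Type} [PseudoEMetricSpace X] [PseudoEMetricSpace Y]
    {f : X → Y} (hf : ∃ K : ℝ≥0, LipschitzWith K f) : lipNorm f ≠ ⊤ := by
  obtain ⟨K, hK⟩ := hf
  exact ne_top_of_le_ne_top ENNReal.coe_ne_top (iInf₂_le K hK)

namespace MPNN

variable {p : ℕ} {r : ℝ}

theorem continuous_feature_and_bounded {L n : ℕ} (φ : MPNN p L n) :
    Continuous (φ.feature r) ∧ ∃ R, 0 ≤ R ∧ ∀ τ, ‖φ.feature r τ‖ ≤ R := by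
  induction φ with
  | start f hf =>
    obtain ⟨R, hR⟩ := exists_norm_le_of_lipschitzWith hf r
    obtain ⟨K, hK⟩ := hf
    exact ⟨hK.continuous.comp IDM.continuous_vec, max R 0, le_max_right _ _,
      fun τ => (hR _ τ.norm_vec_le).trans (le_max_left _ _)⟩
  | layer φ f hf ih =>
    obtain ⟨hc, R, hR0, hR⟩ := ih
    obtain ⟨R', hR'⟩ := exists_norm_le_of_lipschitzWith hf (R + R)
    obtain ⟨K, hK⟩ := hf
    refine ⟨hK.continuous.comp ((WithLp.prod_continuous_toLp 2 _ _).comp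
      ((hc.comp IDM.continuous_init).prodMk
        ((continuous_finiteMeasure_integral hc hR).comp IDM.continuous_last))),
      max R' 0, le_max_right _ _, fun τ => (hR' _ ?_).trans (le_max_left _ _)⟩
    refine (sq_le_sq₀ (norm_nonneg _) (add_nonneg hR0 hR0)).1 ?_
    rw [WithLp.prod_norm_sq_eq_of_L2]
    have h1 := hR τ.init
    have h2 := norm_integral_finiteMeasure_le hR0 hR τ.mass_last_le
    calc ‖φ.feature r τ.init‖ ^ 2 + ‖∫ σ, φ.feature r σ ∂(τ.last : Measure _)‖ ^ 2
        ≤ R ^ 2 + R ^ 2 := by gcongr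
      _ ≤ (R + R) ^ 2 := by nlinarith

theorem continuous_feature {L n : ℕ} (φ : MPNN p L n) : Continuous (φ.feature r) :=
  φ.continuous_feature_and_bounded.1

theorem integrable_feature {L n : ℕ} (φ : MPNN p L n) (μ : FiniteMeasure (IDM p r L)) :
    Integrable (φ.feature r) (μ : Measure (IDM p r L)) := by
  obtain ⟨hc, R, -, hR⟩ := φ.continuous_feature_and_bounded (r := r)
  exact integrable_of_continuous_of_bounded hc hR μ

theorem supNorm_ne_top {L n : ℕ} (φ : MPNN p L n) : φ.supNorm r ≠ ⊤ := by
  obtain ⟨-, R, -, hR⟩ := φ.continuous_feature_and_bounded (r := r)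
  refine ne_top_of_le_ne_top (ENNReal.ofReal_ne_top (r := R)) (iSup_le fun τ => ?_)
  rw [← ofReal_norm]
  exact ENNReal.ofReal_le_ofReal (hR τ)

theorem lipBound_ne_top {L n : ℕ} (φ : MPNN p L n) : φ.lipBound r ≠ ⊤ := by
  induction φ with
  | start f hf => exact lipNorm_ne_top hf
  | layer φ f hf ih =>
    exact ENNReal.mul_ne_top (ENNReal.mul_ne_top (by simp) (lipNorm_ne_top hf))
      (ENNReal.add_ne_top.2 ⟨φ.supNorm_ne_top, ih⟩)

theorem readoutLipBound_ne_top {L n d : ℕ} (φ : MPNN p L n) {ψ : Euc n → Euc d}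
    (hψ : ∃ K : ℝ≥0, LipschitzWith K ψ) : φ.readoutLipBound r ψ ≠ ⊤ :=
  ENNReal.mul_ne_top (lipNorm_ne_top hψ)
    (ENNReal.add_ne_top.2 ⟨φ.supNorm_ne_top, φ.lipBound_ne_top⟩)

/-- Post-composition with a Lipschitz map is absorbed into the last layer. -/
theorem exists_feature_eq_comp {L n m : ℕ} (φ : MPNN p L n) {g : Euc n → Euc m}
    (hg : ∃ K : ℝ≥0, LipschitzWith K g) :
    ∃ φ' : MPNN p L m, ∀ τ : IDM p r L, φ'.feature r τ = g (φ.feature r τ) := by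
  obtain ⟨K, hK⟩ := hg
  cases φ with
  | start f hf =>
    obtain ⟨K', hK'⟩ := hf
    exact ⟨start (g ∘ f) ⟨_, hK.comp hK'⟩, fun _ => rfl⟩
  | layer φ f hf =>
    obtain ⟨K', hK'⟩ := hf
    exact ⟨layer φ (g ∘ f) ⟨_, hK.comp hK'⟩, fun _ => rfl⟩

/-! ### Partitions of unity by hidden features -/

variable (r) in
/-- The coordinates of the hidden representation form a partition of unity on the space of IDMs
whose pieces have diameter at most `η` for the IDM distance. -/
structure IsPartition {L N : ℕ} (φ : MPNN p L N) (η : ℝ) : Prop where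
  nonneg : ∀ (τ : IDM p r L) (i : Fin N), 0 ≤ φ.feature r τ i
  sum_eq_one : ∀ τ : IDM p r L, ∑ i, φ.feature r τ i = 1
  dIDM_le : ∀ (σ τ : IDM p r L) (i : Fin N), φ.feature r σ i ≠ 0 → φ.feature r τ i ≠ 0 →
    dIDM L σ τ ≤ ENNReal.ofReal η

/-- If integrals of the features of a partition of unity agree up to `κ`, then the transport distance
is at most `η` up to an error linear in `κ`. The masses are also compared, since they are the sums
of the integrals of the pieces. -/
theorem IsPartition.OT_le {L N : ℕ} {φ : MPNN p L N} {η κ : ℝ} (hφ : φ.IsPartition r η)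
    (hη : 0 ≤ η) (hκ : 0 ≤ κ) {D : ℝ≥0} (hD : ∀ σ τ : IDM p r L, dIDM L σ τ ≤ D)
    {μ ν : FiniteMeasure (IDM p r L)} (hμ : μ.mass ≤ 1)
    (h : ∀ i, |(∫ τ, φ.feature r τ ∂(μ : Measure (IDM p r L))) i -
      (∫ τ, φ.feature r τ ∂(ν : Measure (IDM p r L))) i| ≤ κ) :
    OT (dIDM L) μ ν ≤ ENNReal.ofReal (η + (D + 1) * (N * κ)) := by
  have hint : ∀ (ρ : FiniteMeasure (IDM p r L)) i,
      Integrable (fun τ => φ.feature r τ i) (ρ : Measure (IDM p r L)) := fun ρ i =>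
    (φ.integrable_feature ρ).eval_piLp i
  have heval : ∀ (ρ : FiniteMeasure (IDM p r L)) i,
      (∫ τ, φ.feature r τ ∂(ρ : Measure (IDM p r L))) i =
        ∫ τ, φ.feature r τ i ∂(ρ : Measure (IDM p r L)) := fun ρ i =>
    eval_integral_piLp (hint ρ) i
  have hmass : ∀ ρ : FiniteMeasure (IDM p r L),
      (ρ.mass : ℝ) = ∑ i, ∫ τ, φ.feature r τ i ∂(ρ : Measure (IDM p r L)) := by
    intro ρ
    rw [← integral_finsetSum _ fun i _ => hint ρ i]
    simp only [hφ.sum_eq_one, integral_const, smul_eq_mul, mul_one]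
    rfl
  simp only [heval] at h
  refine (OT_le_of_partition (χ := fun i τ => ENNReal.ofReal (φ.feature r τ i))
    (η := ENNReal.ofReal η) ?_ ?_ hD ?_ hμ).trans ?_
  · intro i
    have := φ.continuous_feature (r := r)
    exact (Continuous.measurable (by fun_prop)).ennreal_ofReal
  · intro τ
    rw [← ENNReal.ofReal_sum_of_nonneg fun i _ => hφ.nonneg τ i, hφ.sum_eq_one,
      ENNReal.ofReal_one]
  · intro σ τ i hσ hτ
    refine hφ.dIDM_le σ τ i ?_ ?_
    · intro h0
      simp [h0] at hσ
    · intro h0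
      simp [h0] at hτ
  · have h1 : ∑ i, ((∫⁻ τ, ENNReal.ofReal (φ.feature r τ i) ∂(μ : Measure (IDM p r L))) -
        ∫⁻ τ, ENNReal.ofReal (φ.feature r τ i) ∂(ν : Measure (IDM p r L))) ≤
        ENNReal.ofReal (N * κ) := by
      refine (Finset.sum_le_card_nsmul _ _ (ENNReal.ofReal κ) fun i _ => ?_).trans (by
        simp [ENNReal.ofReal_mul])
      rw [← ofReal_integral_eq_lintegral_ofReal (hint μ i)
        (Filter.Eventually.of_forall fun τ => hφ.nonneg τ i),
        ← ofReal_integral_eq_lintegral_ofReal (hint ν i)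
        (Filter.Eventually.of_forall fun τ => hφ.nonneg τ i),
        ← ENNReal.ofReal_sub _ (integral_nonneg fun τ => hφ.nonneg τ i)]
      exact ENNReal.ofReal_le_ofReal ((le_abs_self _).trans (h i))
    have h2 : edist μ.mass ν.mass ≤ ENNReal.ofReal (N * κ) := by
      rw [edist_dist]
      refine ENNReal.ofReal_le_ofReal ?_
      rw [NNReal.dist_eq, hmass, hmass, ← Finset.sum_sub_distrib]
      refine (Finset.abs_sum_le_sum_abs _ _).trans ?_
      simpa using Finset.sum_le_card_nsmul _ _ κ fun i (_ : i ∈ Finset.univ) => h i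
    have hN : 0 ≤ (N : ℝ) * κ := by positivity
    refine (add_le_add (add_le_add le_rfl (mul_le_mul_right h1 _)) h2).trans (le_of_eq ?_)
    rw [ENNReal.ofReal_add hη (by positivity), ENNReal.ofReal_mul (p := (D : ℝ) + 1) (by positivity),
      ENNReal.ofReal_add (by positivity) zero_le_one, ENNReal.ofReal_coe_nnreal,
      ENNReal.ofReal_one]
    ring

/-- A model whose hidden representation controls the IDM distance yields, after composition with
a Lipschitz partition of unity of the range, a partition of unity by hidden features. -/
theorem exists_isPartition_of_separating {L n : ℕ} (φ : MPNN p L n) {η κ : ℝ} (hκ : 0 < κ)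
    (h : ∀ σ τ : IDM p r L, ‖φ.feature r σ - φ.feature r τ‖ ≤ κ →
      dIDM L σ τ ≤ ENNReal.ofReal η) :
    ∃ (N : ℕ) (φ' : MPNN p L N), φ'.IsPartition r η := by
  obtain ⟨-, R, -, hR⟩ := φ.continuous_feature_and_bounded (r := r)
  obtain ⟨N, g, hg, h0, h1, h2⟩ := exists_lipschitz_partition (n := n) R hκ
  obtain ⟨φ', hφ'⟩ := φ.exists_feature_eq_comp (r := r) hg
  refine ⟨N, φ', ⟨fun τ i => ?_, fun τ => ?_, fun σ τ i hσ hτ => h σ τ ?_⟩⟩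
  · rw [hφ']
    exact h0 _ i
  · rw [hφ']
    exact h1 _ (hR τ)
  · rw [hφ'] at hσ hτ
    rw [← dist_eq_norm]
    exact h2 _ _ i hσ hτ

/-- If the features of `σ` and `τ` are closer than `1 / N`, then some piece is positive at both. -/
theorem IsPartition.dIDM_le_of_norm_sub_le {L N : ℕ} {φ : MPNN p L N} {η κ : ℝ}
    (hφ : φ.IsPartition r η) (hκ : N * κ < 1) {σ τ : IDM p r L}
    (h : ‖φ.feature r σ - φ.feature r τ‖ ≤ κ) : dIDM L σ τ ≤ ENNReal.ofReal η := by
  obtain ⟨i, hi⟩ : ∃ i, κ < φ.feature r σ i := by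
    by_contra! hle
    have h1 := Finset.sum_le_card_nsmul _ _ κ fun i (_ : i ∈ Finset.univ) => hle i
    rw [hφ.sum_eq_one] at h1
    simp only [Finset.card_univ, Fintype.card_fin, nsmul_eq_mul] at h1
    linarith
  have h1 : φ.feature r σ i - φ.feature r τ i ≤ κ :=
    ((le_abs_self _).trans (PiLp.norm_apply_le (φ.feature r σ - φ.feature r τ) i)).trans h
  have h2 : 0 ≤ κ := (norm_nonneg _).trans h
  exact hφ.dIDM_le σ τ i (by linarith) (by linarith)

/-- Passing the coordinates of a partition of unity and their integrals unchanged to the next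
layer controls the IDM distance of the next order: the coordinates control the distance of the
initial segments, and their integrals control the transport distance of the last entries. -/
theorem IsPartition.exists_separating {L N : ℕ} {φ : MPNN p L N} {η : ℝ} (hη : 0 < η)
    (hφ : φ.IsPartition r (η / 4)) :
    ∃ (n : ℕ) (φ' : MPNN p (L + 1) n) (κ : ℝ), 0 < κ ∧ ∀ σ τ : IDM p r (L + 1),
      ‖φ'.feature r σ - φ'.feature r τ‖ ≤ κ → dIDM (L + 1) σ τ ≤ ENNReal.ofReal η := by
  obtain ⟨D, hD⟩ := exists_dIDM_le p r L
  let e := (stdOrthonormalBasis ℝ (EucPair N)).repr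
  let κ : ℝ := min (1 / (N + 1)) (η / 2 / ((D + 1) * (N + 1)))
  have hκ0 : 0 < κ := by positivity
  have hκ1 : N * κ < 1 := by
    have h1 : κ * (N + 1) ≤ 1 := (le_div_iff₀ (by positivity)).1 (min_le_left _ _)
    linarith
  have hκ2 : (D + 1) * (N * κ) ≤ η / 2 := by
    have h1 : κ * ((D + 1) * (N + 1)) ≤ η / 2 := (le_div_iff₀ (by positivity)).1 (min_le_right _ _)
    have h2 : 0 ≤ (D + 1) * κ := by positivity
    linarith
  -- The new layer is an isometry, so that no information about the pair is lost.
  refine ⟨_, layer φ e ⟨1, e.lipschitz⟩, κ, hκ0, fun σ τ h => ?_⟩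
  have h' : ‖(WithLp.toLp 2 (φ.feature r σ.init, ∫ ρ, φ.feature r ρ ∂(σ.last : Measure _)) -
      WithLp.toLp 2 (φ.feature r τ.init, ∫ ρ, φ.feature r ρ ∂(τ.last : Measure _)) :
        EucPair N)‖ ≤ κ := by
    rw [← e.norm_map, map_sub]
    exact h
  have h1 := hφ.dIDM_le_of_norm_sub_le hκ1 ((WithLp.norm_fst_le (p := 2) _ _).trans h')
  have h2 := hφ.OT_le (by positivity) hκ0.le hD σ.mass_last_le (ν := τ.last) fun i =>
    (PiLp.norm_apply_le _ i).trans ((WithLp.norm_snd_le (p := 2) _ _).trans h')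
  refine (add_le_add h1 h2).trans ?_
  rw [← ENNReal.ofReal_add (by positivity) (by positivity)]
  exact ENNReal.ofReal_le_ofReal (by linarith)

variable (p r) in
theorem exists_isPartition (L : ℕ) {η : ℝ} (hη : 0 < η) :
    ∃ (N : ℕ) (φ : MPNN p L N), φ.IsPartition r η := by
  induction L generalizing η with
  | zero =>
    refine exists_isPartition_of_separating (start id ⟨1, LipschitzWith.id⟩) hη fun σ τ h => ?_
    rw [dIDM, edist_dist, dist_eq_norm]
    exact ENNReal.ofReal_le_ofReal h
  | succ L ih =>
    obtain ⟨N, φ, hφ⟩ := ih (η := η / 4) (by positivity)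
    obtain ⟨n, φ', κ, hκ, h⟩ := hφ.exists_separating hη
    exact exists_isPartition_of_separating φ' hκ h

end MPNN

/-! ### Fine separation of distributions -/

theorem mainTheorem3 (p : ℕ) (r : ℝ) (hr : 0 < r) (d : ℕ) (hd : 0 < d) (ε : ℝ) (hε : 0 < ε)
    (L : ℕ) :
    ∃ C : ℝ, 0 < C ∧ ∃ δ : ℝ, 0 < δ ∧
      ∀ μ ν : DIDM p r L,
        (∀ (n : ℕ) (φ : MPNN p L n) (ψ : Euc n → Euc d), (∃ K : ℝ≥0, LipschitzWith K ψ) →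
          φ.readoutLipBound r ψ ≤ ENNReal.ofReal C →
            ‖φ.output r ψ μ - φ.output r ψ ν‖ ≤ δ) →
        OT (dIDM L) μ.toFiniteMeasure ν.toFiniteMeasure ≤ ENNReal.ofReal ε := by
  obtain ⟨N, φ, hφ⟩ := MPNN.exists_isPartition p r L (half_pos hε)
  obtain ⟨D, hD⟩ := exists_dIDM_le p r L
  let ψ : Fin N → Euc N → Euc d := fun i x => EuclideanSpace.single ⟨0, hd⟩ (x i)
  have hψd : ∀ i x y, ‖ψ i x - ψ i y‖ = |x i - y i| := fun i x y => by
    rw [← dist_eq_norm, ← Real.dist_eq]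
    exact PiLp.dist_single_same 2 _ _ _ _
  have hψ : ∀ i, ∃ K : ℝ≥0, LipschitzWith K (ψ i) := fun i =>
    ⟨1, LipschitzWith.of_dist_le_mul fun x y => by
      rw [dist_eq_norm, hψd, dist_eq_norm, NNReal.coe_one, one_mul]
      exact PiLp.norm_apply_le (x - y) i⟩
  -- Only the finitely many readouts `ψ i` are tested, so the sum of their bounds is admissible.
  let C : ℝ := (∑ i, φ.readoutLipBound r (ψ i)).toReal + 1
  let δ : ℝ := ε / 2 / ((D + 1) * (N + 1))
  have hδ0 : 0 < δ := by positivity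
  have hδ : (D + 1) * (N * δ) ≤ ε / 2 := by
    have h1 : δ * ((D + 1) * (N + 1)) ≤ ε / 2 := (div_mul_cancel₀ _ (by positivity)).le
    have h2 : 0 ≤ (D + 1) * δ := by positivity
    linarith
  refine ⟨C, by positivity, δ, hδ0, fun μ ν h => ?_⟩
  refine (hφ.OT_le (half_pos hε).le hδ0.le hD (by simp) fun i => ?_).trans
    (ENNReal.ofReal_le_ofReal (by linarith))
  rw [← hψd]
  refine h N φ (ψ i) (hψ i) ?_
  have hfin : ∑ i, φ.readoutLipBound r (ψ i) ≠ ⊤ :=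
    ENNReal.sum_ne_top.2 fun i _ => φ.readoutLipBound_ne_top (hψ i)
  calc φ.readoutLipBound r (ψ i) ≤ ∑ i, φ.readoutLipBound r (ψ i) :=
        Finset.single_le_sum (f := fun i => φ.readoutLipBound r (ψ i))
          (fun _ _ => zero_le) (Finset.mem_univ i)
    _ = ENNReal.ofReal (∑ i, φ.readoutLipBound r (ψ i)).toReal :=
        (ENNReal.ofReal_toReal hfin).symm
    _ ≤ ENNReal.ofReal C := ENNReal.ofReal_le_ofReal (by simp [C])
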